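/- A Mealy automaton $\mathcal M=(Q,A,\tau,\sigma)$ consists of finite sets $Q$ (states) and $A$ (letters) and maps $\sigma:Q\times A\to A$, $\tau:Q\times A\to Q$; write $\sigma_q=\sigma(q,\cdot)$, $\tau_x=\tau(\cdot,x)$. It is invertible if all $\sigma_q$ are bijective, reversible if all $\tau_x$ are bijective, and cyclic if it is invertible and the $\sigma_q$ generate the group generated by a single cycle through all of $A$. A state $q$ acts on finite words over $A$ by $\bar\sigma_q(x_0x_1\cdots x_n)=\sigma(q,x_0)\,\bar\sigma_{\tau(q,x_0)}(x_1\cdots x_n)$, and a letter $x$ acts on finite words over $Q$ by $\bar\tau_x(q_n\cdots q_1q_0)=\bar\tau_{\sigma(q_0,x)}(q_n\cdots q_1)\,\tau(q_0,x)$. The automaton group of an invertible $\mathcal M$ is the group $G_{\mathcal M}$ of permutations of the set of finite words over $A$ generated by the $\bar\sigma_q$. The Schreier graph $\Gamma_{\mathcal M,n}$ is the directed multigraph with vertex set $A^n$ and an edge $s\to\bar\sigma_q(s)$ for all $s\in A^n$, $q\in Q$; its diameter is taken with respect to undirected paths. A family of finite graphs $\Gamma_n$ of bounded degree whose sizes tend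 to infinity is a family of expanders if there is $\varepsilon>0$ such that for all $n$, every set $S$ of at most half of the vertices of $\Gamma_n$ is joined to its complement by at least $\varepsilon|S|$ edges (in either direction, with multiplicity). A group is amenable if it has a left-invariant finitely additive probability measure on all its subsets. Let $\mathcal M$ be the automaton with $Q=\{0,1,2\}$, $A=\{0,1\}$ in which, for $a,b\in Q$ and $x,y\in A$, one has $\sigma(a,x)=y$ and $\tau(a,x)=b$ if and only if $a+3y=x+2b$. Then: 1. If words in $A^n$ are identified with elements of $\mathbb Z/2^n$ by binary expansion (least significant digit on the left), then $\bar\sigma_a(X)=(X-a)/3$ for $a\in Q$. If words in $Q^m$ are identified with elements of $\mathbb Z/3^m$ by ternary expansion (least significant digit on the right), then $\bar\tau_x(W)=(W-x)/2$ for $x\in A$; in particular $\bar\tau_0$ is halving modulo $3^m$. 2. The number $2$ generates $(\mathbb Z/3^m)^*$ for every $m\ge 0$. For every $m\ge1$, the words in $Q^m$ that represent elements of $(\mathbb Z/3^m)^*$ form a single orbit of $\bar\tau_0$, and this orbit has $2\cdot3^{m-1}$ elements. 3. $\mathcal M$ is reversible and cyclic, $|A|=2$ is prime, and there is $K>1$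 such that for all sufficiently large $n$ some $w\in Q^n$ has a $\bar\tau_0$-orbit with at least $K^n$ elements. On the other hand, $\mathcal M$ is not cotransitive: for no $x\in A$ does $\bar\tau_x$ act transitively on $Q^m$ for all $m$. 4. There is a constant $C$ such that $\operatorname{diam}(\Gamma_{\mathcal M,n})\le Cn^2$ for all $n$; in fact there is a constant $C$ such that $\operatorname{diam}(\Gamma_{\mathcal M,n})\le Cn$ for all $n$. 5. The group $G_{\mathcal M}$ is generated by $\mu=\bar\sigma_0^{-1}$ and $\alpha=\bar\sigma_1^{-1}\bar\sigma_0$, which act on each $\mathbb Z/2^n$ as $X\mapsto 3X$ and $X\mapsto X+1$, and $\bar\sigma_2=\mu^{-1}\alpha^{-2}$. There is an injective homomorphism $\varphi:G_{\mathcal M}\to GL_2(\mathbb Q)$ with $\varphi(\mu)=\begin{pmatrix}3&0\\0&1\end{pmatrix}$ and $\varphi(\alpha)=\begin{pmatrix}1&1\\0&1\end{pmatrix}$; every $g\in G_{\mathcal M}$ has $\varphi(g)=\begin{pmatrix}3^k&c/3^l\\0&1\end{pmatrix}$ for some $k,c\in\mathbb Z$ and $l\ge0$, and acts on every $\mathbb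 Z/2^n$ as $X\mapsto 3^kX+c\,3^{-l}$. 6. $G_{\mathcal M}$ is solvable and amenable, and $\{\Gamma_{\mathcal M,n}\}_{n\ge1}$ is not a family of expanders. -/

import Mathlib

/-- A Mealy automaton with finite set of states `Q` and finite alphabet `A`, given by its
output function `σ` and its transition function `τ`. -/
structure MealyAutomaton (Q A : Type*) [Finite Q] [Finite A] where
  σ : Q → A → A
  τ : Q → A → Q

namespace MealyAutomaton

variable {Q A : Type*} [Finite Q] [Finite A]

/-- The dual automaton: states and letters exchange their roles. -/
def dual (M : MealyAutomaton Q A) : MealyAutomaton A Q where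
  σ x q := M.τ q x
  τ x q := M.σ q x

/-- The automaton is invertible if every `σ_q` is a permutation of the alphabet. -/
def Invertible (M : MealyAutomaton Q A) : Prop := ∀ q, Function.Bijective (M.σ q)

/-- The automaton is reversible if its dual is invertible. -/
def Reversible (M : MealyAutomaton Q A) : Prop := M.dual.Invertible

/-- The length-preserving map on finite words over `A` given by a state `q`:
read the first letter `x`, output `σ(q,x)`, act on the rest of the word from state `τ(q,x)`. -/
def act (M : MealyAutomaton Q A) : Q → List A → List A
  | _, [] => []
  | q, x :: s => M.σ q x :: M.act (M.τ q x) s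

theorem length_act (M : MealyAutomaton Q A) (q : Q) (s : List A) :
    (M.act q s).length = s.length := by
  induction s generalizing q with
  | nil => rfl
  | cons x s ih => simp [act, ih]

theorem act_bijective (M : MealyAutomaton Q A) (hM : M.Invertible) (q : Q) :
    Function.Bijective (M.act q) := by
  constructor
  · intro s
    induction s generalizing q with
    | nil =>
      intro t h
      cases t with
      | nil => rfl
      | cons y t => simp [act] at h
    | cons x s ih =>
      intro t h
      cases t with
      | nil => simp [act] at h
      | cons y t =>
        simp only [act, List.cons.injEq] at h
        obtain ⟨h1, h2⟩ := h
        have hxy := (hM q).1 h1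
        subst hxy
        rw [ih _ h2]
  · intro t
    induction t generalizing q with
    | nil => exact ⟨[], rfl⟩
    | cons y t ih =>
      obtain ⟨x, hx⟩ := (hM q).2 y
      obtain ⟨s, hs⟩ := ih (M.τ q x)
      exact ⟨x :: s, by simp [act, hx, hs]⟩

/-- The permutation `σ_q` of the alphabet. -/
noncomputable def letterPerm (M : MealyAutomaton Q A) (hM : M.Invertible) (q : Q) :
    Equiv.Perm A :=
  Equiv.ofBijective (M.σ q) (hM q)

/-- The permutation of the set of finite words over `A` defined by the state `q`. -/
noncomputable def wordPerm (M : MealyAutomaton Q A) (hM : M.Invertible) (q : Q) :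
    Equiv.Perm (List A) :=
  Equiv.ofBijective (M.act q) (M.act_bijective hM q)

/-- The permutation of the set of finite words over `Q` defined by the letter `x` of a reversible
automaton: a word `q_n … q_1 q_0` is read from right to left, the rightmost letter `q_0` is
replaced by `τ(q_0, x)`, and the rest is acted upon by the letter `σ(q_0, x)`.
Up to reversal of words, this is the action of the state `x` of the dual automaton. -/
noncomputable def tauPerm (M : MealyAutomaton Q A) (hR : M.Reversible) (x : A) :
    Equiv.Perm (List Q) :=
  List.reverse_involutive.toPerm * M.dual.wordPerm hR x * List.reverse_involutive.toPerm

/-- The orbit `{τ_x^k(w) | k ∈ ℤ}`. -/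
def tauOrbit (M : MealyAutomaton Q A) (hR : M.Reversible) (x : A) (w : List Q) : Set (List Q) :=
  {v | ∃ k : ℤ, (M.tauPerm hR x ^ k) w = v}

/-- The automaton is cyclic: it is invertible, and the permutations `σ_q` generate the group
generated by one permutation that cycles through the whole alphabet. -/
def Cyclic (M : MealyAutomaton Q A) : Prop :=
  ∃ hM : M.Invertible, ∃ c : Equiv.Perm A, c.IsCycleOn Set.univ ∧
    Subgroup.closure (Set.range (M.letterPerm hM)) = Subgroup.zpowers c

/-- The orbit growth condition at the letter `x` with exponent `α`: for some `K > 1` and all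
sufficiently large `n`, some word of length `n` over `Q` has a `τ_x`-orbit with at least
`K ^ (n ^ α)` elements. -/
def OrbitGrowth (M : MealyAutomaton Q A) (hR : M.Reversible) (x : A) (α : ℝ) : Prop :=
  ∃ K : ℝ, 1 < K ∧ ∀ᶠ n : ℕ in Filter.atTop, ∃ w : List Q, w.length = n ∧
    K ^ ((n : ℝ) ^ α) ≤ ((M.tauOrbit hR x w).ncard : ℝ)

/-- An invertible automaton is transitive if some state acts transitively on every level `A^n`. -/
def Transitive (M : MealyAutomaton Q A) : Prop :=
  ∃ hM : M.Invertible, ∃ q : Q, ∀ s t : List A, s.length = t.length →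
    ∃ k : ℤ, (M.wordPerm hM q ^ k) s = t

/-- The automaton is cotransitive if its dual is transitive. -/
def Cotransitive (M : MealyAutomaton Q A) : Prop := M.dual.Transitive

/-- The automaton group: the group of permutations of the finite words over `A` generated by
the maps of the states. -/
noncomputable def automatonGroup (M : MealyAutomaton Q A) (hM : M.Invertible) :
    Subgroup (Equiv.Perm (List A)) :=
  Subgroup.closure (Set.range (M.wordPerm hM))

/-- The generator of the automaton group given by the state `q`. -/
noncomputable def gen (M : MealyAutomaton Q A) (hM : M.Invertible) (q : Q) :
    M.automatonGroup hM :=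
  ⟨M.wordPerm hM q, Subgroup.subset_closure ⟨q, rfl⟩⟩

/-- The map given by the state `q` on words of length `n`. -/
def levelMap (M : MealyAutomaton Q A) (n : ℕ) (q : Q) : Function.End (List.Vector A n) :=
  fun s => ⟨M.act q s.1, (M.length_act q s.1).trans s.2⟩

/-- The Schreier graph: the directed multigraph on `A^n` with an edge from `s` to the image of `s`
under `q`, for every vertex `s` and every state `q`. -/
abbrev schreierGraph (M : MealyAutomaton Q A) (n : ℕ) :=
  Quiver.SchreierGraph (List.Vector A n) (M.levelMap n)

instance (M : MealyAutomaton Q A) (n : ℕ) : Finite (M.schreierGraph n) :=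
  haveI : Fintype A := Fintype.ofFinite A
  Finite.of_equiv _ (Quiver.SchreierGraph.equiv (List.Vector A n) (M.levelMap n))

end MealyAutomaton

/-- The diameter of a directed multigraph with respect to undirected paths. -/
noncomputable def Quiver.undirectedDiam (V : Type*) [Quiver V] : ℕ∞ :=
  (SimpleGraph.fromRel fun v w : V => Nonempty (v ⟶ w)).ediam

/-- The number of edges of a directed multigraph that join, in either direction, a vertex of `S`
to a vertex outside `S`. -/
noncomputable def Quiver.edgeBoundary {V : Type*} [Quiver V] (S : Set V) : ℕ :=
  Set.ncard {e : Σ v : V, Σ w : V, (v ⟶ w) |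
    (e.1 ∈ S ∧ e.2.1 ∉ S) ∨ (e.1 ∉ S ∧ e.2.1 ∈ S)}

/-- Uniform edge expansion: the requirement that makes a family of finite graphs of
bounded degree, with sizes tending to infinity, a family of expanders. Edges are counted with
multiplicity and without regard to their direction. -/
def IsExpanderFamily {ι : Type*} (V : ι → Type*) [∀ i, Quiver (V i)]
    [∀ i, Finite (V i)] : Prop :=
  ∃ ε : ℝ, 0 < ε ∧ ∀ i, ∀ S : Set (V i), 2 * S.ncard ≤ Nat.card (V i) →
    ε * (S.ncard : ℝ) ≤ (Quiver.edgeBoundary S : ℝ)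

/-- A (discrete) group is amenable if it has a finitely additive, left-invariant probability
measure defined on all subsets. -/
def IsAmenableGroup (G : Type*) [Group G] : Prop :=
  ∃ m : Set G → NNReal, m Set.univ = 1 ∧
    (∀ S T : Set G, Disjoint S T → m (S ∪ T) = m S + m T) ∧
    ∀ (g : G) (S : Set G), m ((fun h => g * h) '' S) = m S

/-- The three-state automaton of division by `3`: state `a`, reading `x`, outputs `y` and moves to
state `b`, where `a + 3 y = x + 2 b`. The rows of the tables are the states, the columns are the
letters. -/
def divThree : MealyAutomaton (Fin 3) (Fin 2) where
  σ := ![![0, 1], ![1, 0], ![0, 1]]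
  τ := ![![0, 1], ![2, 0], ![1, 2]]

theorem divThree_invertible : divThree.Invertible := by
  unfold MealyAutomaton.Invertible Function.Bijective Function.Injective Function.Surjective
  decide

theorem divThree_reversible : divThree.Reversible := by
  unfold MealyAutomaton.Reversible MealyAutomaton.Invertible Function.Bijective
    Function.Injective Function.Surjective
  decide

/-- The number with a given binary expansion, least significant digit on the left. -/
def binaryValue (s : List (Fin 2)) : ℕ := Nat.ofDigits 2 (s.map Fin.val)

/-- The number with a given ternary expansion, least significant digit on the right. -/
def ternaryValue (w : List (Fin 3)) : ℕ := Nat.ofDigits 3 (w.reverse.map Fin.val)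

/-- The unit `3` of `ℤ/2^n`. -/
def threeUnit (n : ℕ) : (ZMod (2 ^ n))ˣ :=
  ZMod.unitOfCoprime 3 (Nat.Coprime.pow_right n (by decide))

/-- The unit `2` of `ℤ/3^m`. -/
def twoUnit (m : ℕ) : (ZMod (3 ^ m))ˣ :=
  ZMod.unitOfCoprime 2 (Nat.Coprime.pow_right m (by decide))

/-- The group of the division by `3` automaton. -/
noncomputable abbrev divThreeGroup : Subgroup (Equiv.Perm (List (Fin 2))) :=
  divThree.automatonGroup divThree_invertible

/-- The element `σ_0⁻¹` of the group. -/
noncomputable def muElt : divThreeGroup := (divThree.gen divThree_invertible 0)⁻¹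

/-- The element `σ_1⁻¹ σ_0` of the group. -/
noncomputable def alphaElt : divThreeGroup :=
  (divThree.gen divThree_invertible 1)⁻¹ * divThree.gen divThree_invertible 0

/-- The words of length `m` over `{0,1,2}` that represent invertible residues modulo `3^m`. -/
def unitWords (m : ℕ) : Set (List (Fin 3)) :=
  {w | w.length = m ∧ IsUnit ((ternaryValue w : ℕ) : ZMod (3 ^ m))}

/-! The relation `a + 3 y = x + 2 b` is one step of a division with carry. Weighted by powers of `2`
and summed along a binary word, it telescopes to `a + 3 Y = X + 2 ^ n b`; weighted by powers of `3`,
with states as digits and letters as carries, it gives `x + 2 W' = W + 3 ^ m y`. Modulo `2 ^ n` and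
`3 ^ m` these are the two affine actions, and the rest is arithmetic.

Orbits of `τ_0` on unit residues are cosets of the subgroup generated by `2`, a primitive root
modulo `3 ^ m`. Traversing an edge backwards is `X ↦ 3 X + a`, so `n` backward steps write `n`
ternary digits and reach every residue.

The group consists of affine maps with coefficients in `ℤ[1/3]`. This ring embeds both in `ℚ` and in
the product of the `ℤ/2^n`, so the coefficients are determined by the action and yield a faithful
matrix representation.

Amenability and non-expansion share one combinatorial estimate, `card_escape_le`. The pairs `(j,
y)`, with `j < J` and `y` in an interval of length `L = J 3 ^ J`, are realised in the group as `μ⁻ʲ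
αʸ` and in the graph as `3⁻ʲ y`. In both places `σ_a⁻¹` acts by `(j + 1, y) ↦ (j, y + a 3 ^ j)`, so
at most `2 L` of the `J L` points escape. -/

/-! ### Words as residues -/

theorem ofDigits_fin_lt {b : ℕ} (hb : 1 < b) (l : List (Fin b)) :
    Nat.ofDigits b (l.map Fin.val) < b ^ l.length := by
  have h := Nat.ofDigits_lt_base_pow_length (l := l.map Fin.val) hb (by simp)
  simpa using h

theorem ofDigits_fin_injective {b : ℕ} (hb : 1 < b) {l l' : List (Fin b)}
    (hl : l.length = l'.length)
    (h : Nat.ofDigits b (l.map Fin.val) = Nat.ofDigits b (l'.map Fin.val)) : l = l' :=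
  List.map_injective_iff.mpr Fin.val_injective
    (Nat.ofDigits_inj_of_len_eq hb (by simpa using hl) (by simp) (by simp) h)

theorem ofDigits_fin_cast_injective {b n : ℕ} (hb : 1 < b) {l l' : List (Fin b)}
    (hl : l.length = n) (hl' : l'.length = n)
    (h : ((Nat.ofDigits b (l.map Fin.val) : ℕ) : ZMod (b ^ n)) =
      (Nat.ofDigits b (l'.map Fin.val) : ℕ)) : l = l' := by
  refine ofDigits_fin_injective hb (hl.trans hl'.symm) ?_
  rw [ZMod.natCast_eq_natCast_iff] at h
  refine Nat.ModEq.eq_of_lt_of_lt h ?_ ?_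
  · exact hl ▸ ofDigits_fin_lt hb l
  · exact hl' ▸ ofDigits_fin_lt hb l'

/-- Words of length `n` over `b` digits, identified with the residues modulo `b ^ n`. -/
noncomputable def digitsEquiv {b : ℕ} (hb : 1 < b) (n : ℕ) :
    List.Vector (Fin b) n ≃ ZMod (b ^ n) := by
  haveI : NeZero (b ^ n) := ⟨by positivity⟩
  refine Equiv.ofBijective
    (fun s => ((Nat.ofDigits b (s.1.map Fin.val) : ℕ) : ZMod (b ^ n))) ?_
  rw [Fintype.bijective_iff_injective_and_card]
  refine ⟨fun s t h => Subtype.ext (ofDigits_fin_cast_injective hb s.2 t.2 h), ?_⟩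
  rw [card_vector, ZMod.card, Fintype.card_fin]

theorem digitsEquiv_apply {b : ℕ} (hb : 1 < b) (n : ℕ) (s : List.Vector (Fin b) n) :
    digitsEquiv hb n s = ((Nat.ofDigits b (s.1.map Fin.val) : ℕ) : ZMod (b ^ n)) := rfl

theorem binaryValue_cons (x : Fin 2) (s : List (Fin 2)) :
    binaryValue (x :: s) = x + 2 * binaryValue s := by
  simp [binaryValue, Nat.ofDigits_cons]

theorem binaryValue_cast_injective {n : ℕ} {s t : List (Fin 2)} (hs : s.length = n)
    (ht : t.length = n) (h : (binaryValue s : ZMod (2 ^ n)) = binaryValue t) : s = t :=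
  ofDigits_fin_cast_injective one_lt_two hs ht h

theorem exists_binaryValue_eq {n : ℕ} (z : ZMod (2 ^ n)) :
    ∃ s : List (Fin 2), s.length = n ∧ (binaryValue s : ZMod (2 ^ n)) = z := by
  obtain ⟨s, hs⟩ := (digitsEquiv one_lt_two n).surjective z
  exact ⟨s.1, s.2, hs⟩

theorem ternaryValue_cast_injective {n : ℕ} {s t : List (Fin 3)} (hs : s.length = n)
    (ht : t.length = n) (h : (ternaryValue s : ZMod (3 ^ n)) = ternaryValue t) : s = t :=
  List.reverse_injective (ofDigits_fin_cast_injective (by norm_num) (by simpa) (by simpa) h)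

theorem exists_ternaryValue_eq {n : ℕ} (z : ZMod (3 ^ n)) :
    ∃ s : List (Fin 3), s.length = n ∧ (ternaryValue s : ZMod (3 ^ n)) = z := by
  obtain ⟨s, hs⟩ := (digitsEquiv (b := 3) (by norm_num) n).surjective z
  refine ⟨s.1.reverse, by simp, ?_⟩
  rw [← hs, ternaryValue, List.reverse_reverse, digitsEquiv_apply]

/-! ### The affine actions of states and letters -/

theorem divThree_eq_iff : ∀ (a b : Fin 3) (x y : Fin 2),
    (divThree.σ a x = y ∧ divThree.τ a x = b) ↔
      (a : ℕ) + 3 * (y : ℕ) = (x : ℕ) + 2 * (b : ℕ) := by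
  decide

theorem divThree_step (a : Fin 3) (x : Fin 2) :
    (a : ℕ) + 3 * (divThree.σ a x : ℕ) = (x : ℕ) + 2 * (divThree.τ a x : ℕ) :=
  (divThree_eq_iff _ _ _ _).mp ⟨rfl, rfl⟩

/-- The step equations telescope; `b` is the state reached after reading `s`, the final carry. -/
theorem exists_binaryValue_act (a : Fin 3) (s : List (Fin 2)) :
    ∃ b : ℕ, (a : ℕ) + 3 * binaryValue (divThree.act a s) =
      binaryValue s + 2 ^ s.length * b := by
  induction s generalizing a with
  | nil => exact ⟨a, by simp [binaryValue, MealyAutomaton.act]⟩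
  | cons x s ih =>
    obtain ⟨b, hb⟩ := ih (divThree.τ a x)
    refine ⟨b, ?_⟩
    rw [MealyAutomaton.act, binaryValue_cons, binaryValue_cons, List.length_cons, pow_succ]
    have := divThree_step a x
    linarith

/-- The same telescoping with letters as carries. The dual automaton reads the least significant
digit first, so no reversal occurs here. -/
theorem exists_ofDigits_dual_act (x : Fin 2) (w : List (Fin 3)) :
    ∃ y : ℕ, (x : ℕ) + 2 * Nat.ofDigits 3 ((divThree.dual.act x w).map Fin.val) =
      Nat.ofDigits 3 (w.map Fin.val) + 3 ^ w.length * y := by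
  induction w generalizing x with
  | nil => exact ⟨x, by simp [MealyAutomaton.act]⟩
  | cons a w ih =>
    obtain ⟨y, hy⟩ := ih (divThree.σ a x)
    refine ⟨y, ?_⟩
    simp only [MealyAutomaton.act, List.map_cons, Nat.ofDigits_cons, List.length_cons, pow_succ]
    have := divThree_step a x
    simp only [MealyAutomaton.dual] at hy ⊢
    linarith

theorem coe_threeUnit (n : ℕ) : (threeUnit n : ZMod (2 ^ n)) = 3 := by
  simp [threeUnit]

theorem coe_twoUnit (m : ℕ) : (twoUnit m : ZMod (3 ^ m)) = 2 := by
  simp [twoUnit]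

theorem three_mul_binaryValue_act {n : ℕ} (a : Fin 3) {s : List (Fin 2)} (hs : s.length = n) :
    3 * (binaryValue (divThree.act a s) : ZMod (2 ^ n)) + ((a : ℕ) : ZMod (2 ^ n)) =
      binaryValue s := by
  obtain ⟨b, hb⟩ := exists_binaryValue_act a s
  have h := congrArg (Nat.cast : ℕ → ZMod (2 ^ n)) hb
  have h0 : (2 : ZMod (2 ^ n)) ^ n = 0 := by exact_mod_cast ZMod.natCast_self (2 ^ n)
  push_cast [hs, h0] at h
  linear_combination h

theorem binaryValue_act {n : ℕ} (a : Fin 3) {s : List (Fin 2)} (hs : s.length = n) :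
    (binaryValue (divThree.act a s) : ZMod (2 ^ n)) =
      ((binaryValue s : ZMod (2 ^ n)) - ((a : ℕ) : ZMod (2 ^ n))) *
        (((threeUnit n)⁻¹ : (ZMod (2 ^ n))ˣ) : ZMod (2 ^ n)) := by
  rw [Units.eq_mul_inv_iff_mul_eq, coe_threeUnit, ← three_mul_binaryValue_act a hs]
  ring

theorem length_tauPerm (x : Fin 2) (w : List (Fin 3)) :
    (divThree.tauPerm divThree_reversible x w).length = w.length := by
  simp [MealyAutomaton.tauPerm, MealyAutomaton.wordPerm, MealyAutomaton.length_act]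

theorem ternaryValue_tauPerm {m : ℕ} (x : Fin 2) {w : List (Fin 3)} (hw : w.length = m) :
    (ternaryValue (divThree.tauPerm divThree_reversible x w) : ZMod (3 ^ m)) =
      ((ternaryValue w : ZMod (3 ^ m)) - ((x : ℕ) : ZMod (3 ^ m))) *
        (((twoUnit m)⁻¹ : (ZMod (3 ^ m))ˣ) : ZMod (3 ^ m)) := by
  obtain ⟨y, hy⟩ := exists_ofDigits_dual_act x w.reverse
  have h := congrArg (Nat.cast : ℕ → ZMod (3 ^ m)) hy
  have h0 : (3 : ZMod (3 ^ m)) ^ m = 0 := by exact_mod_cast ZMod.natCast_self (3 ^ m)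
  push_cast [hw, h0, List.length_reverse] at h
  rw [Units.eq_mul_inv_iff_mul_eq, coe_twoUnit]
  simp only [ternaryValue, MealyAutomaton.tauPerm, MealyAutomaton.wordPerm, Equiv.Perm.mul_apply,
    Function.Involutive.coe_toPerm, Equiv.ofBijective_apply, List.reverse_reverse]
  push_cast
  linear_combination h

/-! ### The primitive root `2` and the orbits of `τ_0` -/

/-- The square `4 = 1 + 3` has order `3 ^ (m - 1)`, and the order of `2` is even because `2` has
order two modulo `3`. -/
theorem orderOf_twoUnit {m : ℕ} (hm : 1 ≤ m) : orderOf (twoUnit m) = 2 * 3 ^ (m - 1) := by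
  obtain ⟨k, rfl⟩ : ∃ k, m = k + 1 := ⟨m - 1, by omega⟩
  rw [Nat.add_sub_cancel]
  have h4 : orderOf (twoUnit (k + 1) ^ 2) = 3 ^ k := by
    rw [← orderOf_units, Units.val_pow_eq_pow_val, coe_twoUnit,
      ← ZMod.orderOf_one_add_prime Nat.prime_three (by norm_num) k]
    norm_num
  have h2 : 2 ∣ orderOf (twoUnit (k + 1)) := by
    have h := orderOf_map_dvd (Units.map
      (ZMod.castHom (dvd_pow_self 3 k.succ_ne_zero) (ZMod 3) : ZMod (3 ^ (k + 1)) →* ZMod 3))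
      (twoUnit (k + 1))
    refine dvd_trans (dvd_of_eq (Eq.symm (orderOf_eq_prime ?_ ?_))) h
    · ext
      simp only [Units.val_pow_eq_pow_val, Units.coe_map,
        coe_twoUnit, MonoidHom.coe_coe, map_ofNat]
      decide
    · intro h1
      have := congrArg Units.val h1
      simp only [Units.coe_map, coe_twoUnit, MonoidHom.coe_coe, map_ofNat] at this
      revert this
      decide
  rw [orderOf_pow' _ two_ne_zero, Nat.gcd_eq_right h2] at h4
  omega

theorem card_units_three_pow {m : ℕ} (hm : 1 ≤ m) :
    Nat.card (ZMod (3 ^ m))ˣ = 2 * 3 ^ (m - 1) := by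
  rw [Nat.card_eq_fintype_card, ZMod.card_units_eq_totient,
    Nat.totient_prime_pow Nat.prime_three hm]
  ring

theorem zpowers_twoUnit (m : ℕ) : Subgroup.zpowers (twoUnit m) = ⊤ := by
  rcases Nat.eq_zero_or_pos m with rfl | hm
  · have : Subsingleton (ZMod (3 ^ 0)) := by rw [pow_zero]; infer_instance
    exact (Subgroup.eq_top_iff' _).mpr fun u => Subsingleton.elim 1 u ▸ one_mem _
  · refine Subgroup.eq_top_of_card_eq _ ?_
    rw [Nat.card_zpowers, orderOf_twoUnit hm, card_units_three_pow hm]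

theorem ncard_unitWords {m : ℕ} (hm : 1 ≤ m) : (unitWords m).ncard = 2 * 3 ^ (m - 1) := by
  rw [← card_units_three_pow hm, ← Nat.card_coe_set_eq]
  refine Nat.card_congr (Equiv.ofBijective (fun w => w.2.2.unit) ⟨fun w v h => ?_, fun u => ?_⟩)
  · refine Subtype.ext (ternaryValue_cast_injective w.2.1 v.2.1 ?_)
    exact congrArg Units.val h
  · obtain ⟨s, hs, h⟩ := exists_ternaryValue_eq (u : ZMod (3 ^ m))
    exact ⟨⟨s, hs, h ▸ u.isUnit⟩, Units.ext h⟩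

theorem ternaryValue_tauPerm_zpow {m : ℕ} {w : List (Fin 3)} (hw : w.length = m) (k : ℤ) :
    ((divThree.tauPerm divThree_reversible 0 ^ k) w).length = m ∧
    (ternaryValue ((divThree.tauPerm divThree_reversible 0 ^ k) w) : ZMod (3 ^ m)) =
      ternaryValue w * ((twoUnit m ^ (-k) : (ZMod (3 ^ m))ˣ) : ZMod (3 ^ m)) := by
  set t := divThree.tauPerm divThree_reversible 0 with ht
  induction k using Int.induction_on with
  | zero => simpa using hw
  | succ k ih =>
    rw [add_comm, zpow_add, zpow_one, Equiv.Perm.mul_apply]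
    refine ⟨(length_tauPerm _ _).trans ih.1, ?_⟩
    rw [ht, ternaryValue_tauPerm 0 ih.1, ih.2, neg_add, zpow_add, zpow_neg_one, Fin.val_zero,
      Nat.cast_zero, Units.val_mul]
    ring
  | pred k ih =>
    -- Negative powers are handled by applying `t` once more, which leads back to the induction
    -- hypothesis.
    have hl : ((t ^ (-(k : ℤ) - 1)) w).length = m := by
      rw [← ih.1, ← length_tauPerm 0 ((t ^ (-(k : ℤ) - 1)) w), ← ht, ← Equiv.Perm.mul_apply,
        ← zpow_one_add]
      congr 3
      ring
    refine ⟨hl, ?_⟩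
    have h := ternaryValue_tauPerm 0 hl
    rw [← ht, ← Equiv.Perm.mul_apply, ← zpow_one_add,
      show (1 : ℤ) + (-(k : ℤ) - 1) = -k by ring, ih.2, Units.eq_mul_inv_iff_mul_eq] at h
    rw [show -(-(k : ℤ) - 1) = -(-(k : ℤ)) + 1 by ring, zpow_add_one, Units.val_mul, ← mul_assoc,
      h]
    simp

theorem tauOrbit_eq_unitWords {m : ℕ} {w : List (Fin 3)} (hw : w ∈ unitWords m) :
    divThree.tauOrbit divThree_reversible 0 w = unitWords m := by
  ext v
  constructor
  · rintro ⟨k, rfl⟩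
    obtain ⟨h1, h2⟩ := ternaryValue_tauPerm_zpow hw.1 k
    exact ⟨h1, h2 ▸ hw.2.mul (Units.isUnit _)⟩
  · intro hv
    obtain ⟨k, hk⟩ := Subgroup.mem_zpowers_iff.mp
      ((zpowers_twoUnit m).symm ▸ Subgroup.mem_top (hw.2.unit⁻¹ * hv.2.unit))
    refine ⟨-k, ?_⟩
    obtain ⟨h1, h2⟩ := ternaryValue_tauPerm_zpow hw.1 (-k)
    refine ternaryValue_cast_injective h1 hv.1 ?_
    rw [h2, neg_neg, hk, Units.val_mul, ← mul_assoc, IsUnit.mul_val_inv, one_mul, IsUnit.unit_spec]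

/-! ### Cyclicity, orbit growth, failure of cotransitivity -/

theorem divThree_cyclic : divThree.Cyclic := by
  refine ⟨divThree_invertible, Equiv.swap 0 1, ?_, le_antisymm ?_ ?_⟩
  · convert Equiv.Perm.isCycleOn_swap (zero_ne_one : (0 : Fin 2) ≠ 1)
    ext x
    fin_cases x <;> simp
  · rw [Subgroup.closure_le]
    rintro _ ⟨q, rfl⟩
    have h : ∀ p : Equiv.Perm (Fin 2), p = 1 ∨ p = Equiv.swap 0 1 := by decide
    rcases h (divThree.letterPerm divThree_invertible q) with h | h <;> rw [h]
    · exact one_mem _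
    · exact Subgroup.mem_zpowers _
  · rw [Subgroup.zpowers_le]
    refine Subgroup.subset_closure ⟨1, Equiv.ext fun x => ?_⟩
    have h : ∀ x, divThree.σ 1 x = Equiv.swap 0 1 x := by decide
    exact h x

theorem divThree_orbitGrowth : divThree.OrbitGrowth divThree_reversible 0 1 := by
  -- The base `2` suffices, since `2 * 3 ^ (n - 1) ≥ 2 ^ n`; the word representing `1` lies in the
  -- large orbit.
  refine ⟨2, one_lt_two, Filter.eventually_atTop.mpr ⟨1, fun n hn => ?_⟩⟩
  obtain ⟨w, hw, h⟩ := exists_ternaryValue_eq (1 : ZMod (3 ^ n))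
  refine ⟨w, hw, ?_⟩
  rw [tauOrbit_eq_unitWords ⟨hw, h ▸ isUnit_one⟩, ncard_unitWords hn, Real.rpow_one,
    Real.rpow_natCast]
  obtain ⟨k, rfl⟩ : ∃ k, n = k + 1 := ⟨n - 1, by omega⟩
  rw [Nat.add_sub_cancel, pow_succ']
  push_cast
  gcongr
  norm_num

theorem divThree_not_cotransitive : ¬ divThree.Cotransitive := by
  rintro ⟨hM, x, hx⟩
  have key (y : Fin 3) (hy : divThree.τ y x = y) : ∀ t : List (Fin 3), t.length = 1 → t = [y] := by
    intro t ht
    obtain ⟨k, rfl⟩ := hx [y] t ht.symm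
    refine Equiv.Perm.zpow_apply_eq_self_of_apply_eq_self ?_ k
    simp [MealyAutomaton.wordPerm, MealyAutomaton.act, MealyAutomaton.dual, hy]
  -- The map `W ↦ (W - x) / 2` fixes `W = -x`, that is, `0` or `2` modulo `3`; transitivity already
  -- fails at length one.
  have hfix : ∀ x, ∃ y, divThree.τ y x = y := by decide
  have hne : ∀ y : Fin 3, [y + 1] ≠ [y] := by decide
  obtain ⟨y, hy⟩ := hfix x
  exact hne y (key y hy [y + 1] rfl)

/-! ### Linear diameter -/

/-- An edge labelled `a`, traversed backwards, is `X ↦ 3 X + a`; the labels along the path are the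
ternary digits of `r`. The induction strips the last digit from `t`. -/
theorem edist_schreierGraph_le {n : ℕ} (k : ℕ) (s t : divThree.schreierGraph n)
    (r : ℕ) (hr : r < 3 ^ k)
    (h : (binaryValue t.toVertex.1 : ZMod (2 ^ n)) = 3 ^ k * binaryValue s.toVertex.1 + r) :
    (SimpleGraph.fromRel fun v w : divThree.schreierGraph n => Nonempty (v ⟶ w)).edist s t ≤ k := by
  induction k generalizing t r with
  | zero =>
    have hst : s = t := by
      refine Quiver.SchreierGraph.ext (Subtype.ext
        (binaryValue_cast_injective s.toVertex.2 t.toVertex.2 ?_))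
      obtain rfl : r = 0 := by simpa using hr
      simp [h]
    simp [hst]
  | succ k ih =>
    obtain ⟨a, ha⟩ : ∃ a : Fin 3, (a : ℕ) = r % 3 := ⟨⟨r % 3, Nat.mod_lt _ (by norm_num)⟩, rfl⟩
    let t' : divThree.schreierGraph n := ⟨divThree.levelMap n a t.toVertex⟩
    have hr3 : r / 3 < 3 ^ k := by rw [pow_succ] at hr; omega
    have h1 := ih t' (r / 3) hr3 (by
      rw [show t'.toVertex.1 = divThree.act a t.toVertex.1 from rfl, binaryValue_act a t.toVertex.2,
        Units.mul_inv_eq_iff_eq_mul, coe_threeUnit, h, ha, pow_succ]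
      have := congrArg (Nat.cast : ℕ → ZMod (2 ^ n)) (Nat.div_add_mod r 3)
      push_cast at this
      linear_combination -this)
    have h2 : (SimpleGraph.fromRel fun v w : divThree.schreierGraph n =>
        Nonempty (v ⟶ w)).edist t' t ≤ 1 := by
      rw [SimpleGraph.edist_le_one_iff_adj_or_eq, SimpleGraph.fromRel_adj]
      by_cases htt : t' = t
      · exact Or.inr htt
      · exact Or.inl ⟨htt, Or.inr ⟨⟨a, rfl⟩⟩⟩
    push_cast
    exact SimpleGraph.edist_triangle.trans (add_le_add h1 h2)

theorem undirectedDiam_schreierGraph_le (n : ℕ) :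
    Quiver.undirectedDiam (divThree.schreierGraph n) ≤ n := by
  refine SimpleGraph.ediam_le_of_edist_le fun s t => ?_
  have : NeZero (2 ^ n) := ⟨by positivity⟩
  -- Since `2 ^ n ≤ 3 ^ n`, every residue can serve as the remainder after `n` steps.
  refine edist_schreierGraph_le n s t ((binaryValue t.toVertex.1 : ZMod (2 ^ n)) -
    3 ^ n * binaryValue s.toVertex.1).val ?_ ?_
  · exact (ZMod.val_lt _).trans_le (Nat.pow_le_pow_left (by norm_num) n)
  · rw [ZMod.natCast_zmod_val]
    ring

/-! ### The coefficient ring and its reductions -/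

/-- The ring `ℤ[1/3]`. -/
abbrev IntInvThree := Localization.Away (3 : ℤ)

namespace IntInvThree

theorem isUnit_three : IsUnit (3 : IntInvThree) := by
  simpa using IsLocalization.Away.algebraMap_isUnit (S := IntInvThree) (3 : ℤ)

/-- The unit `3` of `ℤ[1/3]`. -/
noncomputable def three : IntInvThreeˣ := isUnit_three.unit

theorem coe_three : (three : IntInvThree) = 3 := rfl

/-- The inclusion of `ℤ[1/3]` in `ℚ`. -/
noncomputable def toRat : IntInvThree →+* ℚ :=
  IsLocalization.Away.lift (3 : ℤ) (g := Int.castRingHom ℚ) (by simp)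

/-- The reduction of `ℤ[1/3]` modulo `2 ^ n`. -/
noncomputable def toZMod (n : ℕ) : IntInvThree →+* ZMod (2 ^ n) :=
  IsLocalization.Away.lift (3 : ℤ) (g := Int.castRingHom (ZMod (2 ^ n))) (by
    simpa [coe_threeUnit] using (threeUnit n).isUnit)

@[simp]
theorem toRat_three : toRat 3 = 3 := map_ofNat toRat 3

@[simp]
theorem toZMod_three (n : ℕ) : toZMod n 3 = 3 := map_ofNat (toZMod n) 3

theorem map_three (n : ℕ) : Units.map (toZMod n : IntInvThree →* ZMod (2 ^ n)) three =
    threeUnit n := by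
  ext
  simp [coe_three, coe_threeUnit]

theorem exists_mul_pow (r : IntInvThree) : ∃ (c : ℤ) (l : ℕ), r * 3 ^ l = c := by
  obtain ⟨l, c, h⟩ := IsLocalization.Away.surj (3 : ℤ) r
  exact ⟨c, l, by simpa using h⟩

theorem eq_zero_of_toRat {r : IntInvThree} (h : toRat r = 0) : r = 0 := by
  obtain ⟨c, l, hc⟩ := exists_mul_pow r
  have hc' := congrArg toRat hc
  rw [map_mul, h, zero_mul, map_intCast, eq_comm, Int.cast_eq_zero] at hc'
  rw [hc', Int.cast_zero] at hc
  exact ((isUnit_three.pow l).mul_left_eq_zero).mp hc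

/-- After clearing denominators, an integer `c` divisible by every power of `2` remains, and `|c| <
2 ^ |c|` forces `c = 0`. This makes the coefficients of an affine action unique. -/
theorem eq_zero_of_toZMod {r : IntInvThree} (h : ∀ n, toZMod n r = 0) : r = 0 := by
  obtain ⟨c, l, hc⟩ := exists_mul_pow r
  have hdvd (n : ℕ) : (2 ^ n : ℤ) ∣ c := by
    have hc' := congrArg (toZMod n) hc
    rw [map_mul, h, zero_mul, map_intCast, eq_comm, ZMod.intCast_zmod_eq_zero_iff_dvd] at hc'
    exact_mod_cast hc'
  have hc0 : c = 0 := by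
    refine Int.eq_zero_of_abs_lt_dvd (hdvd c.natAbs) ?_
    rw [Int.abs_eq_natAbs]
    exact_mod_cast Nat.lt_two_pow_self
  rw [hc0, Int.cast_zero] at hc
  exact ((isUnit_three.pow l).mul_left_eq_zero).mp hc

theorem toRat_injective : Function.Injective toRat :=
  (injective_iff_map_eq_zero _).mpr fun _ => eq_zero_of_toRat

theorem eq_of_toZMod {r r' : IntInvThree} (h : ∀ n, toZMod n r = toZMod n r') : r = r' :=
  sub_eq_zero.mp (eq_zero_of_toZMod fun n => by rw [map_sub, h, sub_self])

end IntInvThree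

/-! ### Affine permutations of words -/

open IntInvThree in
/-- The permutation `g` of the binary words acts on words of every length `n` as the affine map
`X ↦ u X + r` of `ℤ/2^n`, where `u` is a power of `3`. -/
def IsAffineOnWords (g : Equiv.Perm (List (Fin 2))) (u : IntInvThreeˣ) (r : IntInvThree) : Prop :=
  u ∈ Subgroup.zpowers three ∧ ∀ (n : ℕ) (s : List (Fin 2)), s.length = n →
    (g s).length = n ∧ (binaryValue (g s) : ZMod (2 ^ n)) =
      toZMod n u * binaryValue s + toZMod n r

namespace IsAffineOnWords

open IntInvThree

variable {g h : Equiv.Perm (List (Fin 2))} {u v : IntInvThreeˣ} {r q : IntInvThree}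

theorem one : IsAffineOnWords 1 1 0 :=
  ⟨one_mem _, fun n s hs => ⟨hs, by simp⟩⟩

theorem mul (hg : IsAffineOnWords g u r) (hh : IsAffineOnWords h v q) :
    IsAffineOnWords (g * h) (u * v) (u * q + r) := by
  refine ⟨mul_mem hg.1 hh.1, fun n s hs => ?_⟩
  obtain ⟨h1, h2⟩ := hh.2 n s hs
  obtain ⟨h3, h4⟩ := hg.2 n _ h1
  refine ⟨h3, ?_⟩
  rw [Equiv.Perm.mul_apply, h4, h2, Units.val_mul, map_mul, map_add, map_mul]
  ring

theorem ext (hg : IsAffineOnWords g u r) (hh : IsAffineOnWords h u r) : g = h :=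
  Equiv.ext fun s => binaryValue_cast_injective (hg.2 _ s rfl).1 (hh.2 _ s rfl).1
    ((hg.2 _ s rfl).2.trans (hh.2 _ s rfl).2.symm)

/-- The values at `0` and `1` on every level determine the coefficients. -/
theorem unique (hg : IsAffineOnWords g u r) (hg' : IsAffineOnWords g v q) : u = v ∧ r = q := by
  have key (n : ℕ) (z : ZMod (2 ^ n)) : toZMod n u * z + toZMod n r =
      toZMod n v * z + toZMod n q := by
    obtain ⟨s, hs, rfl⟩ := exists_binaryValue_eq z
    exact (hg.2 n s hs).2.symm.trans (hg'.2 n s hs).2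
  have hr : r = q := eq_of_toZMod fun n => by simpa using key n 0
  refine ⟨Units.ext (eq_of_toZMod fun n => ?_), hr⟩
  simpa [hr] using key n 1

theorem inv (hg : IsAffineOnWords g u r) :
    IsAffineOnWords g⁻¹ u⁻¹ (-(((u⁻¹ : IntInvThreeˣ) : IntInvThree) * r)) := by
  refine ⟨inv_mem hg.1, fun n s hs => ?_⟩
  -- The preimage of `s` is constructed by solving the affine equation among words of length `n`,
  -- which also shows that `g⁻¹` preserves length.
  obtain ⟨t, ht, hts⟩ := exists_binaryValue_eq (toZMod n ((u⁻¹ : IntInvThreeˣ) : IntInvThree) *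
    ((binaryValue s : ZMod (2 ^ n)) - toZMod n r))
  obtain ⟨h1, h2⟩ := hg.2 n t ht
  have hu : toZMod n u * toZMod n ((u⁻¹ : IntInvThreeˣ) : IntInvThree) = 1 := by
    rw [← map_mul, Units.mul_inv, map_one]
  have hgt : g t = s := by
    refine binaryValue_cast_injective h1 hs ?_
    rw [h2, hts, ← mul_assoc, hu]
    ring
  have hgs : g⁻¹ s = t := Equiv.Perm.inv_eq_iff_eq.mpr hgt.symm
  rw [hgs, hts, map_neg, map_mul]
  exact ⟨ht, by ring⟩

theorem gen (a : Fin 3) : IsAffineOnWords (divThree.gen divThree_invertible a) three⁻¹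
    (-(((three⁻¹ : IntInvThreeˣ) : IntInvThree) * (a : ℕ))) := by
  refine ⟨inv_mem (Subgroup.mem_zpowers _), fun n s hs => ⟨?_, ?_⟩⟩
  · exact (divThree.length_act a s).trans hs
  · refine (binaryValue_act a hs).trans ?_
    rw [← map_three, ← map_inv, Units.coe_map, MonoidHom.coe_coe, map_neg, map_mul, map_natCast]
    ring

theorem exists_of_mem (g : divThreeGroup) :
    ∃ p : IntInvThreeˣ × IntInvThree, IsAffineOnWords g p.1 p.2 := by
  obtain ⟨g, hg⟩ := g
  induction hg using Subgroup.closure_induction with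
  | mem x hx =>
    obtain ⟨a, rfl⟩ := hx
    exact ⟨(_, _), gen a⟩
  | one => exact ⟨(1, 0), one⟩
  | mul x y _ _ hx hy =>
    obtain ⟨p, hp⟩ := hx
    obtain ⟨q, hq⟩ := hy
    exact ⟨(_, _), hp.mul hq⟩
  | inv x _ hx =>
    obtain ⟨p, hp⟩ := hx
    exact ⟨(_, _), hp.inv⟩

end IsAffineOnWords

/-! ### Coefficients, matrices and generators -/

open IntInvThree

/-- The coefficients `(u, r)` of the affine map `X ↦ u X + r` given by an element of the group. -/
noncomputable def affineCoeff (g : divThreeGroup) : IntInvThreeˣ × IntInvThree :=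
  (IsAffineOnWords.exists_of_mem g).choose

theorem isAffineOnWords_affineCoeff (g : divThreeGroup) :
    IsAffineOnWords g (affineCoeff g).1 (affineCoeff g).2 :=
  (IsAffineOnWords.exists_of_mem g).choose_spec

theorem affineCoeff_eq {g : divThreeGroup} {u : IntInvThreeˣ} {r : IntInvThree}
    (h : IsAffineOnWords g u r) : affineCoeff g = (u, r) :=
  Prod.ext_iff.mpr ((isAffineOnWords_affineCoeff g).unique h)

theorem affineCoeff_one : affineCoeff 1 = (1, 0) := affineCoeff_eq .one

theorem affineCoeff_mul (g h : divThreeGroup) : affineCoeff (g * h) =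
    ((affineCoeff g).1 * (affineCoeff h).1,
      (affineCoeff g).1 * (affineCoeff h).2 + (affineCoeff g).2) :=
  affineCoeff_eq ((isAffineOnWords_affineCoeff g).mul (isAffineOnWords_affineCoeff h))

theorem affineCoeff_injective : Function.Injective affineCoeff := fun g h hgh =>
  Subtype.ext ((isAffineOnWords_affineCoeff g).ext (hgh ▸ isAffineOnWords_affineCoeff h))

theorem affineCoeff_gen (a : Fin 3) : affineCoeff (divThree.gen divThree_invertible a) =
    (three⁻¹, -(((three⁻¹ : IntInvThreeˣ) : IntInvThree) * (a : ℕ))) :=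
  affineCoeff_eq (.gen a)

theorem affineCoeff_muElt : affineCoeff muElt = (three, 0) := by
  have h := affineCoeff_eq (g := muElt) (IsAffineOnWords.gen 0).inv
  simpa using h

theorem affineCoeff_alphaElt : affineCoeff alphaElt = (1, 1) := by
  have h := affineCoeff_eq (g := alphaElt) ((IsAffineOnWords.gen 1).inv.mul (.gen 0))
  refine h.trans (Prod.ext (by simp) ?_)
  have h3 := Units.mul_inv three
  simp only [inv_inv, Fin.val_zero, Fin.val_one, Nat.cast_zero, Nat.cast_one]
  linear_combination h3

/-- The linear part of the affine maps given by the elements of the group. -/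
noncomputable def linearPart : divThreeGroup →* IntInvThreeˣ where
  toFun g := (affineCoeff g).1
  map_one' := by rw [affineCoeff_one]
  map_mul' g h := by rw [affineCoeff_mul]

/-- The elements of the group as affine upper triangular matrices. -/
noncomputable def affineMatrix : divThreeGroup →* Matrix (Fin 2) (Fin 2) ℚ where
  toFun g := !![toRat (affineCoeff g).1, toRat (affineCoeff g).2; 0, 1]
  map_one' := by simp [affineCoeff_one, Matrix.one_fin_two]
  map_mul' g h := by simp [affineCoeff_mul]

theorem affineMatrix_injective : Function.Injective affineMatrix := by
  intro g h hgh
  refine affineCoeff_injective (Prod.ext (Units.ext (toRat_injective ?_)) (toRat_injective ?_))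
  · exact congrFun (congrFun hgh 0) 0
  · exact congrFun (congrFun hgh 0) 1

theorem exists_affine_formula (g : divThreeGroup) : ∃ (k c : ℤ) (l : ℕ),
    affineMatrix g = !![3 ^ k, (c : ℚ) / 3 ^ l; 0, 1] ∧
    ∀ (n : ℕ) (s : List (Fin 2)), s.length = n →
      (binaryValue ((g : Equiv.Perm (List (Fin 2))) s) : ZMod (2 ^ n)) =
        ((threeUnit n ^ k : (ZMod (2 ^ n))ˣ) : ZMod (2 ^ n)) * (binaryValue s : ZMod (2 ^ n)) +
          (c : ZMod (2 ^ n)) * (((threeUnit n ^ l)⁻¹ : (ZMod (2 ^ n))ˣ) : ZMod (2 ^ n)) := by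
  have hg := isAffineOnWords_affineCoeff g
  obtain ⟨k, hk⟩ := Subgroup.mem_zpowers_iff.mp hg.1
  obtain ⟨c, l, hc⟩ := exists_mul_pow (affineCoeff g).2
  refine ⟨k, c, l, ?_, fun n s hs => ?_⟩
  · have h1 : toRat (affineCoeff g).1 = 3 ^ k := by
      have h := congrArg Units.val (map_zpow (Units.map (toRat : IntInvThree →* ℚ)) three k)
      rw [hk] at h
      simpa [coe_three] using h
    have h2 : toRat (affineCoeff g).2 = c / 3 ^ l := by
      rw [eq_div_iff (by positivity)]
      simpa using congrArg toRat hc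
    simp [affineMatrix, h1, h2]
  · rw [(hg.2 n s hs).2, ← map_three, ← map_zpow, hk]
    congr 1
    rw [Units.eq_mul_inv_iff_mul_eq]
    simpa [coe_three] using congrArg (toZMod n) hc

theorem binaryValue_muElt {n : ℕ} {s : List (Fin 2)} (hs : s.length = n) :
    (binaryValue ((muElt : Equiv.Perm (List (Fin 2))) s) : ZMod (2 ^ n)) =
      3 * (binaryValue s : ZMod (2 ^ n)) := by
  have h := ((isAffineOnWords_affineCoeff muElt).2 n s hs).2
  rw [affineCoeff_muElt] at h
  simpa [coe_three] using h

theorem binaryValue_alphaElt {n : ℕ} {s : List (Fin 2)} (hs : s.length = n) :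
    (binaryValue ((alphaElt : Equiv.Perm (List (Fin 2))) s) : ZMod (2 ^ n)) =
      (binaryValue s : ZMod (2 ^ n)) + 1 := by
  have h := ((isAffineOnWords_affineCoeff alphaElt).2 n s hs).2
  rw [affineCoeff_alphaElt] at h
  simpa using h

theorem affineCoeff_alphaElt_pow (k : ℕ) : affineCoeff (alphaElt ^ k) = (1, (k : IntInvThree)) := by
  induction k with
  | zero => simp [affineCoeff_one]
  | succ k ih => simp [pow_succ', affineCoeff_mul, ih, affineCoeff_alphaElt]

theorem affineCoeff_muElt_pow (k : ℕ) : affineCoeff (muElt ^ k) = (three ^ k, 0) := by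
  induction k with
  | zero => simp [affineCoeff_one]
  | succ k ih => simp [pow_succ', affineCoeff_mul, ih, affineCoeff_muElt]

/-- Both sides are `X ↦ 3 X + a`: tripling followed by `a` increments. -/
theorem gen_inv_eq (a : Fin 3) :
    (divThree.gen divThree_invertible a)⁻¹ = alphaElt ^ (a : ℕ) * muElt := by
  rw [inv_eq_iff_mul_eq_one]
  refine affineCoeff_injective ?_
  rw [affineCoeff_mul, affineCoeff_mul, affineCoeff_gen, affineCoeff_alphaElt_pow,
    affineCoeff_muElt, affineCoeff_one]
  simp

theorem gen_two_eq : divThree.gen divThree_invertible 2 = muElt⁻¹ * (alphaElt ^ 2)⁻¹ := by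
  rw [← mul_inv_rev, ← inv_inv (divThree.gen _ _), gen_inv_eq]
  rfl

theorem closure_gen : Subgroup.closure (Set.range (divThree.gen divThree_invertible)) = ⊤ := by
  have h : Set.range (divThree.gen divThree_invertible) =
      ((↑) : divThreeGroup → Equiv.Perm (List (Fin 2))) ⁻¹'
        Set.range (divThree.wordPerm divThree_invertible) := by
    ext g
    simp only [Set.mem_range, Set.mem_preimage]
    exact exists_congr fun a => Subtype.ext_iff
  rw [h]
  exact Subgroup.closure_closure_coe_preimage

theorem closure_muElt_alphaElt :
    Subgroup.closure {muElt, alphaElt} = (⊤ : Subgroup divThreeGroup) := by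
  rw [eq_top_iff, ← closure_gen, Subgroup.closure_le]
  rintro _ ⟨a, rfl⟩
  rw [SetLike.mem_coe, ← inv_mem_iff, gen_inv_eq]
  exact mul_mem (pow_mem (Subgroup.subset_closure (by simp)) _) (Subgroup.subset_closure (by simp))

/-! ### Solvability -/

/-- The kernel of the linear part consists of translations, which commute, and the linear part takes
values in a commutative group. -/
theorem isSolvable_divThreeGroup : Group.IsSolvable divThreeGroup := by
  have hker : ∀ x y : linearPart.ker, x * y = y * x := by
    rintro ⟨x, hx⟩ ⟨y, hy⟩
    have hx' : (affineCoeff x).1 = 1 := hx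
    have hy' : (affineCoeff y).1 = 1 := hy
    refine Subtype.ext (affineCoeff_injective ?_)
    simp only [Subgroup.coe_mul, affineCoeff_mul, hx', hy']
    simp [add_comm]
  have : Group.IsSolvable linearPart.ker := Group.isSolvable_of_comm hker
  exact Group.isSolvable_of_ker_le_range linearPart.ker.subtype linearPart (by simp)

/-! ### Følner's criterion -/

open Filter Topology in
open scoped Classical in
/-- Følner's criterion: a group that has a sequence of finite sets asymptotically invariant under
a set of generators is amenable. -/
theorem isAmenableGroup_of_folner {G : Type*} [Group G] (T : Set G)
    (hT : Subgroup.closure T = ⊤) (F : ℕ → Finset G) (hF : ∀ n, (F n).Nonempty)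
    (hinv : ∀ g ∈ T, Tendsto (fun n => (((F n).filter fun x => g * x ∉ F n).card : NNReal) /
      (F n).card) atTop (𝓝 0)) : IsAmenableGroup G := by
  let d (S : Set G) (n : ℕ) : NNReal := (((F n).filter fun x => x ∈ S).card : NNReal) / (F n).card
  have hcard (n : ℕ) : ((F n).card : NNReal) ≠ 0 := by
    exact_mod_cast (Finset.card_pos.mpr (hF n)).ne'
  -- The measure is the limit of the densities along a nonprincipal ultrafilter; it exists because
  -- `[0, 1]` is compact.
  have hlim (S : Set G) : ∃ x, Tendsto (d S) (hyperfilter ℕ) (𝓝 x) := by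
    obtain ⟨x, -, hx⟩ := (isCompact_Icc (a := (0 : NNReal)) (b := 1)).ultrafilter_le_nhds
      ((hyperfilter ℕ).map (d S)) (by
        rw [le_principal_iff]
        refine Ultrafilter.mem_map.mpr (univ_mem' fun n => ⟨zero_le, ?_⟩)
        exact div_le_one_of_le₀ (Nat.cast_le.mpr (Finset.card_filter_le _ _)) zero_le)
    exact ⟨x, hx⟩
  choose m hm using hlim
  have huniv : m Set.univ = 1 := by
    refine tendsto_nhds_unique (hm Set.univ) (tendsto_const_nhds.congr fun n => ?_)
    simp [d, hcard n]
  have hadd (S U : Set G) (hSU : Disjoint S U) : m (S ∪ U) = m S + m U := by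
    refine tendsto_nhds_unique (hm _) (((hm S).add (hm U)).congr fun n => ?_)
    simp only [d, Set.mem_union]
    rw [Finset.filter_or, Finset.card_union_of_disjoint, Nat.cast_add, add_div]
    exact Finset.disjoint_filter.mpr fun x _ h1 h2 => Set.disjoint_left.mp hSU h1 h2
  have hcompl (S : Set G) : m S + m Sᶜ = 1 := by
    rw [← hadd S Sᶜ disjoint_compl_right, Set.union_compl_self, huniv]
  have hle (g : G) (hg : g ∈ T) (S : Set G) : m S ≤ m ((fun h => g * h) '' S) := by
    have h := (hm ((fun h => g * h) '' S)).add ((hinv g hg).mono_left Nat.hyperfilter_le_atTop)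
    rw [add_zero] at h
    refine le_of_tendsto_of_tendsto' (hm S) h fun n => ?_
    simp only [d]
    rw [← add_div]
    gcongr
    norm_cast
    -- Translation by `g` maps `S ∩ F n` into `gS ∩ F n`, except for the points leaving `F n`, whose
    -- density tends to zero.
    rw [← Finset.card_image_of_injective ((F n).filter fun x => x ∈ S) (mul_right_injective g),
      ← Finset.card_image_of_injective ((F n).filter fun x => g * x ∉ F n)
        (mul_right_injective g)]
    refine (Finset.card_le_card fun y hy => ?_).trans (Finset.card_union_le _ _)
    simp only [Finset.mem_image, Finset.mem_filter, Finset.mem_union] at hy ⊢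
    obtain ⟨x, ⟨hx, hxS⟩, rfl⟩ := hy
    by_cases hgx : g * x ∈ F n
    · exact Or.inl ⟨hgx, x, hxS, rfl⟩
    · exact Or.inr ⟨x, ⟨hx, hgx⟩, rfl⟩
  have heq (g : G) (hg : g ∈ T) (S : Set G) : m ((fun h => g * h) '' S) = m S := by
    refine le_antisymm ?_ (hle g hg S)
    -- The one-sided inequality for `S` and for its complement, with both pairs of measures summing
    -- to `1`, forces equality.
    have h1 := hle g hg Sᶜ
    rw [Set.image_compl_eq (Group.mulLeft_bijective g)] at h1
    have h2 := hcompl S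
    rw [← hcompl ((fun h => g * h) '' S)] at h2
    by_contra! hlt
    exact absurd h2 (add_lt_add_of_lt_of_le hlt h1).ne
  refine ⟨m, huniv, hadd, fun g => ?_⟩
  have hg : g ∈ Subgroup.closure T := hT ▸ Subgroup.mem_top g
  induction hg using Subgroup.closure_induction with
  | mem g hg => exact heq g hg
  | one => simp
  | mul g h _ _ ihg ihh =>
    intro S
    rw [← ihh S, ← ihg ((fun x => h * x) '' S), Set.image_image]
    simp only [mul_assoc]
  | inv g _ ih =>
    intro S
    rw [← ih, Set.image_image]
    simp

/-! ### The common Følner estimate -/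

/-- The index set of the Følner sets: pairs `(j, y)` with `j < J` and `y` in an interval. -/
def folnerIndex (J : ℕ) : Finset (ℕ × ℕ) :=
  Finset.range J ×ˢ Finset.Ico (J * 3 ^ J) (2 * (J * 3 ^ J))

theorem card_folnerIndex (J : ℕ) : (folnerIndex J).card = J * (J * 3 ^ J) := by
  rw [folnerIndex, Finset.card_product, Finset.card_range, Nat.card_Ico]
  congr 1
  omega

theorem mem_folnerIndex {J : ℕ} {p : ℕ × ℕ} :
    p ∈ folnerIndex J ↔ p.1 < J ∧ J * 3 ^ J ≤ p.2 ∧ p.2 < 2 * (J * 3 ^ J) := by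
  rw [folnerIndex, Finset.mem_product, Finset.mem_range, Finset.mem_Ico]

open scoped Classical in
/-- A map that sends the point `(j + 1, y)` to `(j, y + c 3 ^ j)`, where `c ≤ 2`, moves few points
out of the Følner set. -/
theorem card_escape_le {X : Type*} (ψ : ℕ × ℕ → X) (g : X → X) {c : ℕ} (hc : c ≤ 2)
    (hg : ∀ j y, g (ψ (j + 1, y)) = ψ (j, y + c * 3 ^ j)) (J : ℕ) :
    (((folnerIndex J).image ψ).filter fun x => g x ∉ (folnerIndex J).image ψ).card ≤
      2 * (J * 3 ^ J) := by
  set L := J * 3 ^ J with hL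
  -- A point can escape only from the layer `j = 0` or from the top `3 ^ J` values of `y`, as `c * 3
  -- ^ j ≤ 3 ^ J`. The two pieces have at most `L` and `J * 3 ^ J = L` points.
  have hsub : ((folnerIndex J).image ψ).filter (fun x => g x ∉ (folnerIndex J).image ψ) ⊆
      ({0} ×ˢ Finset.Ico L (2 * L) ∪ Finset.range J ×ˢ Finset.Ico (2 * L - 3 ^ J) (2 * L)).image
        ψ := by
    intro x hx
    rw [Finset.mem_filter, Finset.mem_image] at hx
    obtain ⟨⟨⟨j, y⟩, hp, rfl⟩, hx⟩ := hx
    refine Finset.mem_image_of_mem ψ ?_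
    rw [mem_folnerIndex, ← hL] at hp
    obtain ⟨h1, h2, h3⟩ := hp
    rcases j with _ | j
    · simp [h2, h3]
    · refine Finset.mem_union_right _ ?_
      rw [hg] at hx
      have hlt : 2 * L ≤ y + c * 3 ^ j := by
        by_contra! h
        exact hx (Finset.mem_image_of_mem ψ (mem_folnerIndex.mpr ⟨by omega, by omega, h⟩))
      have hpow : c * 3 ^ j ≤ 3 ^ J := calc
        c * 3 ^ j ≤ 3 * 3 ^ j := Nat.mul_le_mul_right _ (by omega)
        _ = 3 ^ (j + 1) := (pow_succ' 3 j).symm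
        _ ≤ 3 ^ J := Nat.pow_le_pow_right (by norm_num) h1.le
      rw [Finset.mem_product, Finset.mem_range, Finset.mem_Ico]
      exact ⟨h1, by omega, h3⟩
  refine (Finset.card_le_card hsub).trans (Finset.card_image_le.trans
    ((Finset.card_union_le _ _).trans ?_))
  rw [Finset.card_product, Finset.card_product, Finset.card_singleton, Finset.card_range,
    Nat.card_Ico, Nat.card_Ico, two_mul L, Nat.add_sub_cancel, one_mul]
  refine Nat.add_le_add_left ?_ _
  rw [hL]
  exact Nat.mul_le_mul_left _ tsub_tsub_le

/-! ### Amenability -/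

open IntInvThree

/-- The element `μ⁻ʲ αʸ` of the group. -/
noncomputable def folnerElt (p : ℕ × ℕ) : divThreeGroup := (muElt ^ p.1)⁻¹ * alphaElt ^ p.2

/-- The relation `μʲ α = α^(3ʲ) μʲ` moves the factor `αᵃ` past `μ⁻ʲ`. -/
theorem gen_inv_mul_folnerElt (a : Fin 3) (j y : ℕ) :
    (divThree.gen divThree_invertible a)⁻¹ * folnerElt (j + 1, y) =
      folnerElt (j, y + a * 3 ^ j) := by
  have hrel (j : ℕ) : muElt ^ j * alphaElt ^ (a : ℕ) = alphaElt ^ (a * 3 ^ j : ℕ) * muElt ^ j := by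
    refine affineCoeff_injective ?_
    simp only [affineCoeff_mul, affineCoeff_alphaElt_pow, affineCoeff_muElt_pow]
    simp [coe_three, mul_comm]
  rw [gen_inv_eq, folnerElt, folnerElt, eq_inv_mul_iff_mul_eq, add_comm y, pow_add,
    ← mul_assoc, ← mul_assoc, ← mul_assoc, hrel, pow_succ]
  group

theorem folnerElt_injective : Function.Injective folnerElt := by
  rintro ⟨i, x⟩ ⟨j, y⟩ h
  have hlin : three ^ i = three ^ j := by
    have hmu : linearPart muElt = three := congrArg Prod.fst affineCoeff_muElt
    have hal : linearPart alphaElt = 1 := congrArg Prod.fst affineCoeff_alphaElt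
    simpa [folnerElt, hmu, hal] using congrArg linearPart h
  obtain rfl : i = j := by
    have h3 := congrArg (fun u : IntInvThreeˣ => toRat u) hlin
    simp only [Units.val_pow_eq_pow_val, coe_three, map_pow, toRat_three] at h3
    exact pow_right_injective₀ (by norm_num) (by norm_num) h3
  have h2 := congrArg affineCoeff (mul_left_cancel h)
  rw [affineCoeff_alphaElt_pow, affineCoeff_alphaElt_pow, Prod.mk.injEq] at h2
  have h3 := congrArg toRat h2.2
  rw [map_natCast, map_natCast, Nat.cast_inj] at h3
  exact Prod.ext rfl h3

theorem isAmenable_divThreeGroup : IsAmenableGroup divThreeGroup := by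
  classical
  refine isAmenableGroup_of_folner (Set.range fun a => (divThree.gen divThree_invertible a)⁻¹) ?_
    -- The shift to `J + 1` keeps the sets nonempty; the escaping proportion is at most `2 / (J +
    -- 1)`.
    (fun J => (folnerIndex (J + 1)).image folnerElt) (fun J => ?_) ?_
  · rw [← Set.inv_range, Subgroup.closure_inv, closure_gen]
  · rw [Finset.image_nonempty, ← Finset.card_pos, card_folnerIndex]
    positivity
  · rintro _ ⟨a, rfl⟩
    have hlim : Filter.Tendsto (fun J : ℕ => (2 : NNReal) * (1 / ((J : NNReal) + 1))) Filter.atTop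
        (nhds 0) := by
      simpa using (tendsto_one_div_add_atTop_nhds_zero_nat (𝕜 := NNReal)).const_mul 2
    refine tendsto_of_tendsto_of_tendsto_of_le_of_le tendsto_const_nhds hlim
      (fun J => zero_le) fun J => ?_
    have h := card_escape_le folnerElt (fun x => (divThree.gen divThree_invertible a)⁻¹ * x)
      (c := a) (by omega) (gen_inv_mul_folnerElt a) (J + 1)
    dsimp only
    rw [Finset.card_image_of_injective _ folnerElt_injective, card_folnerIndex,
      mul_one_div]
    rw [div_le_div_iff₀ (by positivity) (by positivity)]
    norm_cast
    calc _ ≤ 2 * ((J + 1) * 3 ^ (J + 1)) * (J + 1) := Nat.mul_le_mul_right _ (by convert h)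
      _ = _ := by ring

/-! ### Failure of expansion -/

/-- The vertices of the Schreier graph, identified with the residues modulo `2 ^ n`. -/
noncomputable def vertexEquiv (n : ℕ) : divThree.schreierGraph n ≃ ZMod (2 ^ n) :=
  (Quiver.SchreierGraph.equiv (List.Vector (Fin 2) n) (divThree.levelMap n)).symm.trans
    (digitsEquiv one_lt_two n)

theorem vertexEquiv_smul {n : ℕ} (a : Fin 3) (v : divThree.schreierGraph n) :
    3 * vertexEquiv n (divThree.levelMap n a • v) + ((a : ℕ) : ZMod (2 ^ n)) =
      vertexEquiv n v :=
  three_mul_binaryValue_act a v.toVertex.2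

/-- The inverse of the action of the state `a` on the vertices of the Schreier graph. -/
noncomputable def backMap (n : ℕ) (a : Fin 3) (v : divThree.schreierGraph n) :
    divThree.schreierGraph n :=
  (vertexEquiv n).symm (3 * vertexEquiv n v + ((a : ℕ) : ZMod (2 ^ n)))

theorem backMap_smul {n : ℕ} (a : Fin 3) (v : divThree.schreierGraph n) :
    backMap n a (divThree.levelMap n a • v) = v := by
  rw [backMap, vertexEquiv_smul, Equiv.symm_apply_apply]

theorem backMap_injective (n : ℕ) (a : Fin 3) : Function.Injective (backMap n a) := by
  intro v w h
  have h1 := (vertexEquiv n).symm.injective h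
  have h3 : IsUnit (3 : ZMod (2 ^ n)) := coe_threeUnit n ▸ (threeUnit n).isUnit
  exact (vertexEquiv n).injective (h3.mul_left_cancel (add_right_cancel h1))

theorem smul_backMap {n : ℕ} (a : Fin 3) (v : divThree.schreierGraph n) :
    divThree.levelMap n a • backMap n a v = v :=
  backMap_injective n a (backMap_smul a _)

-- Since `σ_a` permutes the vertices, as many points of `S` leave under it as under its inverse. The
-- factor `6` counts three labels and two directions.
open scoped Classical in
theorem edgeBoundary_le {n : ℕ} (S : Finset (divThree.schreierGraph n)) {B : ℕ}
    (hB : ∀ a, (S.filter fun v => backMap n a v ∉ S).card ≤ B) :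
    Quiver.edgeBoundary (S : Set (divThree.schreierGraph n)) ≤ 6 * B := by
  have : Fintype (divThree.schreierGraph n) := Fintype.ofFinite _
  have hout (a : Fin 3) : (S.filter fun v => divThree.levelMap n a • v ∉ S).card ≤ B := by
    have h1 := Finset.card_filter_add_card_filter_not (s := S)
      (fun v => divThree.levelMap n a • v ∈ S)
    have h2 := Finset.card_filter_add_card_filter_not (s := S) (fun v => backMap n a v ∈ S)
    have h3 : (S.filter fun v => backMap n a v ∈ S).card ≤
        (S.filter fun v => divThree.levelMap n a • v ∈ S).card := by
      refine Finset.card_le_card_of_injOn (backMap n a) (fun v hv => ?_)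
        (backMap_injective n a).injOn
      rw [Finset.mem_coe, Finset.mem_filter] at hv ⊢
      exact ⟨hv.2, (smul_backMap a v).symm ▸ hv.1⟩
    have := hB a
    omega
  let E (p : Σ _ : Fin 3, divThree.schreierGraph n) :
      Σ v : divThree.schreierGraph n, Σ w : divThree.schreierGraph n, (v ⟶ w) :=
    ⟨p.2, divThree.levelMap n p.1 • p.2, p.1, rfl⟩
  let P := (Finset.univ.sigma fun a => S.filter fun v => divThree.levelMap n a • v ∉ S) ∪
    Finset.univ.sigma fun a => (S.filter fun v => backMap n a v ∉ S).image (backMap n a)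
  have hsub : {e : Σ v : divThree.schreierGraph n, Σ w : divThree.schreierGraph n, (v ⟶ w) |
      (e.1 ∈ (S : Set _) ∧ e.2.1 ∉ (S : Set _)) ∨ (e.1 ∉ (S : Set _) ∧ e.2.1 ∈ (S : Set _))} ⊆
      (P.image E : Finset _) := by
    rintro ⟨v, _, a, rfl⟩ he
    rw [Finset.mem_coe, Finset.mem_image]
    refine ⟨⟨a, v⟩, ?_, rfl⟩
    simp only [P, Finset.mem_union, Finset.mem_sigma, Finset.mem_univ, true_and,
      Finset.mem_filter, Finset.mem_image]
    rcases he with ⟨h1, h2⟩ | ⟨h1, h2⟩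
    · exact Or.inl ⟨h1, h2⟩
    · exact Or.inr ⟨_, ⟨h2, (backMap_smul a v).symm ▸ h1⟩, backMap_smul a v⟩
  refine (Set.ncard_le_ncard hsub (Finset.finite_toSet _)).trans ?_
  rw [Set.ncard_coe_finset]
  refine (Finset.card_image_le.trans (Finset.card_union_le _ _)).trans ?_
  rw [Finset.card_sigma, Finset.card_sigma]
  have h1 := Finset.sum_le_card_nsmul Finset.univ _ B fun a _ => hout a
  have h2 := Finset.sum_le_card_nsmul Finset.univ _ B fun a _ =>
    (Finset.card_image_le (f := backMap n a)).trans (hB a)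
  rw [Finset.card_univ, Fintype.card_fin, smul_eq_mul] at h1 h2
  omega

/-- The vertex `3⁻ʲ y` of the Schreier graph. -/
noncomputable def folnerVertex (n : ℕ) (p : ℕ × ℕ) : divThree.schreierGraph n :=
  (vertexEquiv n).symm ((((threeUnit n ^ p.1)⁻¹ : (ZMod (2 ^ n))ˣ) : ZMod (2 ^ n)) * p.2)

theorem backMap_folnerVertex (n : ℕ) (a : Fin 3) (j y : ℕ) :
    backMap n a (folnerVertex n (j + 1, y)) = folnerVertex n (j, y + a * 3 ^ j) := by
  rw [backMap, folnerVertex, folnerVertex, Equiv.apply_symm_apply, EmbeddingLike.apply_eq_iff_eq,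
    Units.eq_inv_mul_iff_mul_eq]
  have h := Units.mul_inv (threeUnit n ^ (j + 1))
  rw [Units.val_pow_eq_pow_val, coe_threeUnit] at h ⊢
  simp only [Nat.cast_add, Nat.cast_mul, Nat.cast_pow, Nat.cast_ofNat]
  linear_combination (y : ZMod (2 ^ n)) * h

/-- A coincidence gives `3 ^ d * x = y` modulo `2 ^ n`, hence in the integers, as both sides are
below `2 ^ n`. If `d > 0`, then `y ≥ 3 L`, whereas `y < 2 L`; this is why the interval starts at `L`
and not at `0`. -/
theorem folnerVertex_injOn {n J : ℕ} (hn : 2 * (J * 3 ^ J) * 3 ^ J ≤ 2 ^ n) :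
    Set.InjOn (folnerVertex n) (folnerIndex J) := by
  set L := J * 3 ^ J with hL
  have key (i d x y : ℕ) (hi : i + d < J) (hx : L ≤ x) (hx' : x < 2 * L) (hy' : y < 2 * L)
      (h : folnerVertex n (i, x) = folnerVertex n (i + d, y)) : (i, x) = (i + d, y) := by
    have h1 := (vertexEquiv n).symm.injective h
    dsimp only at h1
    rw [pow_add, mul_inv, Units.val_mul, mul_assoc, Units.mul_right_inj,
      Units.eq_inv_mul_iff_mul_eq, Units.val_pow_eq_pow_val, coe_threeUnit] at h1
    have h2 : ((3 ^ d * x : ℕ) : ZMod (2 ^ n)) = (y : ℕ) := by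
      push_cast
      exact h1
    have hd : 3 ^ d ≤ 3 ^ J := Nat.pow_le_pow_right (by norm_num) (by omega)
    have h3 : 3 ^ d * x = y := by
      rw [ZMod.natCast_eq_natCast_iff] at h2
      refine Nat.ModEq.eq_of_lt_of_lt h2 ?_ ?_
      · calc 3 ^ d * x < 3 ^ d * (2 * L) := Nat.mul_lt_mul_of_pos_left hx' (by positivity)
          _ ≤ 3 ^ J * (2 * L) := Nat.mul_le_mul_right _ hd
          _ ≤ 2 ^ n := by rwa [mul_comm]
      · refine hy'.trans_le (le_trans ?_ hn)
        exact Nat.le_mul_of_pos_right _ (by positivity)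
    rcases d with _ | d
    · simpa using h3
    · have : 3 * x ≤ 3 ^ (d + 1) * x :=
        Nat.mul_le_mul_right _ (Nat.le_self_pow d.succ_ne_zero 3)
      omega
  rintro ⟨i, x⟩ hp ⟨j, y⟩ hq h
  rw [Finset.mem_coe, mem_folnerIndex, ← hL] at hp hq
  obtain ⟨hi, hx, hx'⟩ := hp
  obtain ⟨hj, hy, hy'⟩ := hq
  dsimp only at *
  rcases le_total i j with hij | hij
  · obtain ⟨d, rfl⟩ := Nat.exists_eq_add_of_le hij
    exact key i d x y hj hx hx' hy' h
  · obtain ⟨d, rfl⟩ := Nat.exists_eq_add_of_le hij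
    exact (key j d y x hi hy hy' hx' h.symm).symm

theorem not_isExpanderFamily :
    ¬ IsExpanderFamily (fun n : ℕ+ => divThree.schreierGraph (n : ℕ)) := by
  classical
  rintro ⟨ε, hε, h⟩
  -- The boundary has at most `12 L` edges and the set has `J L` vertices, so expansion would give
  -- `ε J ≤ 12`.
  obtain ⟨K, hK⟩ := exists_nat_gt (12 / ε)
  set J := K + 1 with hJ
  set L := J * 3 ^ J with hL
  have hLpos : 0 < L := by positivity
  let n : ℕ+ := ⟨2 * L * 3 ^ J, by positivity⟩
  have hn : 2 * L * 3 ^ J ≤ 2 ^ (n : ℕ) := Nat.lt_two_pow_self.le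
  set S : Finset (divThree.schreierGraph n) := (folnerIndex J).image (folnerVertex n) with hS
  have hcard : S.card = J * L := by
    rw [hS, Finset.card_image_of_injOn (folnerVertex_injOn hn), card_folnerIndex]
  have hB : Quiver.edgeBoundary (S : Set (divThree.schreierGraph n)) ≤ 6 * (2 * L) :=
    edgeBoundary_le S fun a =>
      card_escape_le (folnerVertex n) (backMap n a) (c := a) (by omega)
        (backMap_folnerVertex n a) J
  -- The set fills at most half of the graph: `2 J L ≤ 2 L 3 ^ J ≤ 2 ^ n`.
  have hh := h n S (by
    rw [Set.ncard_coe_finset, hcard, Nat.card_congr (vertexEquiv n), Nat.card_zmod]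
    refine le_trans ?_ hn
    rw [mul_left_comm, mul_comm J]
    exact Nat.mul_le_mul_left _ (Nat.lt_pow_self (by norm_num)).le)
  rw [Set.ncard_coe_finset, hcard] at hh
  have h1 : ε * ((J * L : ℕ) : ℝ) ≤ 12 * L := hh.trans (by
    calc _ ≤ ((6 * (2 * L) : ℕ) : ℝ) := Nat.cast_le.mpr hB
      _ = 12 * L := by push_cast; ring)
  have hL' : (0 : ℝ) < L := by exact_mod_cast hLpos
  have h2 : ε * J ≤ 12 := by
    refine le_of_mul_le_mul_right ?_ hL'
    push_cast at h1
    linarith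
  rw [div_lt_iff₀ hε] at hK
  have h3 : (J : ℝ) = K + 1 := by rw [hJ]; push_cast; ring
  rw [h3] at h2
  nlinarith

/-! ### Assembly -/

theorem mainTheorem7 :
    -- the automaton is given by the equation `a + 3 y = x + 2 b`
    (∀ (a b : Fin 3) (x y : Fin 2), (divThree.σ a x = y ∧ divThree.τ a x = b) ↔
      (a : ℕ) + 3 * (y : ℕ) = (x : ℕ) + 2 * (b : ℕ)) ∧
    -- the states act on binary words by `X ↦ (X - a) / 3` modulo `2 ^ n`
    (∀ (n : ℕ) (a : Fin 3) (s : List (Fin 2)), s.length = n →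
      ((binaryValue (divThree.act a s) : ℕ) : ZMod (2 ^ n)) =
        ((binaryValue s : ZMod (2 ^ n)) - ((a : ℕ) : ZMod (2 ^ n))) *
          (((threeUnit n)⁻¹ : (ZMod (2 ^ n))ˣ) : ZMod (2 ^ n))) ∧
    -- the letters act on ternary words by `W ↦ (W - x) / 2` modulo `3 ^ m`
    (∀ (m : ℕ) (x : Fin 2) (w : List (Fin 3)), w.length = m →
      ((ternaryValue (divThree.tauPerm divThree_reversible x w) : ℕ) : ZMod (3 ^ m)) =
        ((ternaryValue w : ZMod (3 ^ m)) - ((x : ℕ) : ZMod (3 ^ m))) *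
          (((twoUnit m)⁻¹ : (ZMod (3 ^ m))ˣ) : ZMod (3 ^ m))) ∧
    -- `2` generates the unit group of `ℤ/3^m`, and that group is one orbit of `τ_0`
    (∀ m : ℕ, Subgroup.zpowers (twoUnit m) = ⊤) ∧
    (∀ m : ℕ, 1 ≤ m → (unitWords m).ncard = 2 * 3 ^ (m - 1) ∧
      ∀ w ∈ unitWords m, divThree.tauOrbit divThree_reversible 0 w = unitWords m) ∧
    -- the hypotheses of the orbit theorem, with exponent `1`, hold; no cotransitivity
    divThree.Reversible ∧ divThree.Cyclic ∧ (Nat.card (Fin 2)).Prime ∧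
    divThree.OrbitGrowth divThree_reversible 0 1 ∧
    ¬ divThree.Cotransitive ∧
    -- the diameter is `O(n ^ 2)`, and even `O(n)`
    (∃ C : ℕ, ∀ n : ℕ,
      Quiver.undirectedDiam (divThree.schreierGraph n) ≤ ((C * n ^ 2 : ℕ) : ℕ∞)) ∧
    (∃ C : ℕ, ∀ n : ℕ,
      Quiver.undirectedDiam (divThree.schreierGraph n) ≤ ((C * n : ℕ) : ℕ∞)) ∧
    -- the group is generated by multiplication by `3` and addition of `1`
    Subgroup.closure {muElt, alphaElt} = (⊤ : Subgroup divThreeGroup) ∧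
    divThree.gen divThree_invertible 2 = muElt⁻¹ * (alphaElt ^ 2)⁻¹ ∧
    (∀ (n : ℕ) (s : List (Fin 2)), s.length = n →
      ((binaryValue ((muElt : Equiv.Perm (List (Fin 2))) s) : ℕ) : ZMod (2 ^ n)) =
        3 * (binaryValue s : ZMod (2 ^ n))) ∧
    (∀ (n : ℕ) (s : List (Fin 2)), s.length = n →
      ((binaryValue ((alphaElt : Equiv.Perm (List (Fin 2))) s) : ℕ) : ZMod (2 ^ n)) =
        (binaryValue s : ZMod (2 ^ n)) + 1) ∧
    -- it is a group of affine upper triangular matrices, acting by `X ↦ 3 ^ k X + c / 3 ^ l`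
    (∃ φ : divThreeGroup →* GL (Fin 2) ℚ, Function.Injective φ ∧
      (φ muElt : Matrix (Fin 2) (Fin 2) ℚ) = !![3, 0; 0, 1] ∧
      (φ alphaElt : Matrix (Fin 2) (Fin 2) ℚ) = !![1, 1; 0, 1] ∧
      ∀ g : divThreeGroup, ∃ (k c : ℤ) (l : ℕ),
        (φ g : Matrix (Fin 2) (Fin 2) ℚ) = !![3 ^ k, (c : ℚ) / 3 ^ l; 0, 1] ∧
        ∀ (n : ℕ) (s : List (Fin 2)), s.length = n →
          ((binaryValue ((g : Equiv.Perm (List (Fin 2))) s) : ℕ) : ZMod (2 ^ n)) =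
            ((threeUnit n ^ k : (ZMod (2 ^ n))ˣ) : ZMod (2 ^ n)) * (binaryValue s : ZMod (2 ^ n)) +
              (c : ZMod (2 ^ n)) * (((threeUnit n ^ l)⁻¹ : (ZMod (2 ^ n))ˣ) : ZMod (2 ^ n))) ∧
    -- solvable, amenable, no expanders
    Group.IsSolvable divThreeGroup ∧
    IsAmenableGroup divThreeGroup ∧
    ¬ IsExpanderFamily (fun n : ℕ+ => divThree.schreierGraph (n : ℕ)) := by
  refine ⟨divThree_eq_iff, fun n a s hs => binaryValue_act a hs,
    fun m x w hw => ternaryValue_tauPerm x hw, zpowers_twoUnit,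
    fun m hm => ⟨ncard_unitWords hm, fun w hw => tauOrbit_eq_unitWords hw⟩,
    divThree_reversible, divThree_cyclic, by simpa using Nat.prime_two, divThree_orbitGrowth,
    divThree_not_cotransitive, ⟨1, fun n => ?_⟩, ⟨1, fun n => ?_⟩, closure_muElt_alphaElt,
    gen_two_eq, fun n s hs => binaryValue_muElt hs, fun n s hs => binaryValue_alphaElt hs,
    -- A monoid homomorphism defined on a group takes values in the units, here `GL (Fin 2) ℚ`.
    ⟨affineMatrix.toHomUnits, fun g h hgh => affineMatrix_injective (congrArg Units.val hgh),
      ?_, ?_, exists_affine_formula⟩,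
    isSolvable_divThreeGroup, isAmenable_divThreeGroup, not_isExpanderFamily⟩
  · rw [one_mul]
    exact (undirectedDiam_schreierGraph_le n).trans
      (Nat.cast_le.mpr (Nat.le_self_pow two_ne_zero n))
  · rw [one_mul]
    exact undirectedDiam_schreierGraph_le n
  · simp [affineMatrix, affineCoeff_muElt, IntInvThree.coe_three]
  · simp [affineMatrix, affineCoeff_alphaElt]
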